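/- Let $S^3$ be the 3-sphere and let $K\subset S^3$ be a tame knot, given with a tubular neighbourhood, i.e. an open embedding $\varphi\colon\mathbb C\times S^1\to S^3$ with $\varphi(0\times S^1)=K$; the fibres $\mathbb C\times w$ are oriented by the standard orientation of $\mathbb C$, which fixes an orientation of the normal bundle of $K$. Let $N_K=\varphi(\{|v|\le 1\}\times S^1)$ be the regular neighbourhood, $\partial N_K$ its boundary torus, identified with $T^2=S^1\times S^1$ by $\varphi$, and $E_K=S^3-\operatorname{Int}N_K$; fix a basepoint $z\in E_K$. For $p=\varphi(u,w)\in\partial N_K$ let $m_p(t)=\varphi(ue^{2\pi i t},w)$ be the positive meridian loop at $p$. The fundamental quandle $Q(K)$ is the set of homotopy classes of paths in $E_K$ from a point of $\partial N_K$ to $z$, where during a homotopy the initial point may move in $\partial N_K$ and the final point is fixed, with the operations $$[a]\triangleright[b]=[a\cdot\bar b\cdot m_{b(0)}\cdot b],\qquad [a]\triangleleft[b]=[a\cdot\bar b\cdot\overline{m}_{b(0)}\cdot b].$$ A quandle automorphism (resp. antiautomorphism) of $Q(K)$ is a bijection $F\colon Q(K)\to Q(K)$ with $F(x\triangleright y)=F(x)\triangleright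 F(y)$ (resp. $F(x\triangleright y)=F(x)\triangleleft F(y)$) for all $x,y$. Let $f\colon S^3\to S^3$ be a homeomorphism with $f(K)=K$ and $f(N_K)=N_K$ such that the class $[f|_{\partial N_K}]$ in the group $MCG(T^2)$ of isotopy classes of self-homeomorphisms of the torus is $1$ or $-1$, where $-1$ is the class of $(u,w)\mapsto(u^{-1},w^{-1})$. We say that $f$ preserves (resp. reverses) the orientation of the normal bundle of $K$ if it carries positive meridians to loops that are freely homotopic in $N_K-K$ to positive (resp. negative) meridians. Then: 1. $f$ preserves or reverses the orientation of the normal bundle. 2. If $f(z)=z$, then $f_*([a])=[f\circ a]$ is a well-defined bijection $f_*\colon Q(K)\to Q(K)$. It is a quandle automorphism if $f$ preserves the orientation of the normal bundle, and a quandle antiautomorphism if $f$ reverses it. 3. In general there is a path in $E_K$ from $f(z)$ to $z$, and for every such path $\gamma$ the map $f_*([a])=[(f\circ a)\cdot\gamma]$ is a well-defined bijection $Q(K)\to Q(K)$, which is a quandle automorphism if $f$ preserves the orientation of the normal bundle, and a quandle antiautomorphism if $f$ reverses it. -/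

import Mathlib

open Set unitInterval
open scoped Quandles

/-! ### Mapping class groups -/

/-- A self-homeomorphism of `X` is isotopic to the identity if it is the time-one map of a
level-preserving self-homeomorphism of `[0,1] × X` that is the identity at time zero. -/
def IsotopicToId {X : Type*} [TopologicalSpace X] (g : X ≃ₜ X) : Prop :=
  ∃ Φ : (I × X) ≃ₜ (I × X), (∀ q, (Φ q).1 = q.1) ∧
    (∀ x, Φ (0, x) = (0, x)) ∧ (∀ x, Φ (1, x) = (1, g x))

/-- The subgroup `Homeo₀(X)` of self-homeomorphisms isotopic to the identity. -/
def homeoZero (X : Type*) [TopologicalSpace X] : Subgroup (X ≃ₜ X) where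
  carrier := {g | IsotopicToId g}
  one_mem' := ⟨Homeomorph.refl _, fun _ => rfl, fun _ => rfl, fun _ => rfl⟩
  mul_mem' := by
    rintro g h ⟨Φ, h1, h2, h3⟩ ⟨Ψ, k1, k2, k3⟩
    refine ⟨Ψ.trans Φ, fun q => ?_, fun x => ?_, fun x => ?_⟩
    · simp [h1, k1]
    · simp [h2, k2]
    · simp [h3, k3]
  inv_mem' := by
    rintro g ⟨Φ, h1, h2, h3⟩
    refine ⟨Φ.symm, fun q => ?_, fun x => ?_, fun x => ?_⟩
    · rw [← h1 (Φ.symm q), Φ.apply_symm_apply]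
    · rw [Φ.symm_apply_eq, h2]
    · rw [Φ.symm_apply_eq, h3]
      exact congrArg (Prod.mk 1) (g.apply_symm_apply x).symm

instance (X : Type*) [TopologicalSpace X] : (homeoZero X).Normal where
  conj_mem := by
    rintro g ⟨Φ, h1, h2, h3⟩ k
    refine ⟨(((Homeomorph.refl I).prodCongr k).symm.trans Φ).trans
      ((Homeomorph.refl I).prodCongr k), fun q => ?_, fun x => ?_, fun x => ?_⟩
    · simp [h1]
    · simp [h2]
    · simp only [Homeomorph.trans_apply, Homeomorph.prodCongr_symm, Homeomorph.coe_prodCongr,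
        Prod.map_apply, Homeomorph.refl_symm, Homeomorph.refl_apply, id_eq, h3]
      rfl

/-- The (extended) mapping class group: self-homeomorphisms modulo isotopy. -/
abbrev MCG (X : Type*) [TopologicalSpace X] : Type _ := (X ≃ₜ X) ⧸ homeoZero X

/-- The mapping class of a self-homeomorphism. -/
def MCG.mk {X : Type*} [TopologicalSpace X] (g : X ≃ₜ X) : MCG X := QuotientGroup.mk g

/-- The torus `T² = S¹ × S¹`. -/
abbrev Torus : Type := Circle × Circle

/-- The class `-1 ∈ MCG(T²)`, i.e. that of `(u, w) ↦ (u⁻¹, w⁻¹)`, which acts on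
`H₁(T²) = ℤ²` as minus the identity matrix. -/
noncomputable def MCG.negOne : MCG Torus := MCG.mk (Homeomorph.inv Torus)

/-! ### Knots, regular neighbourhoods, exteriors -/

/-- The 3-sphere. -/
abbrev S3 : Type := Metric.sphere (0 : EuclideanSpace ℝ (Fin 4)) 1

/-- A (tame) knot in the 3-sphere together with a trivialised tubular neighbourhood, given by an
open embedding of `ℂ × S¹` that takes `0 × S¹` onto the knot. The fibres `ℂ × w` are the fibres of
the normal bundle, and its orientation is the one carried over from the standard orientation
of `ℂ`. -/
structure Knot where
  /-- The underlying subset `K` of the 3-sphere. -/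
  carrier : Set S3
  /-- The tubular neighbourhood. -/
  tube : ℂ × Circle → S3
  isOpenEmbedding : Topology.IsOpenEmbedding tube
  image_core : tube '' ({0} ×ˢ univ) = carrier

namespace Knot

variable (K : Knot)

/-- The closed regular neighbourhood `N_K`: the unit disc bundle. -/
def nbhd : Set S3 := K.tube '' (Metric.closedBall 0 1 ×ˢ univ)

/-- The boundary torus `∂N_K`. -/
def boundary : Set S3 := frontier K.nbhd

/-- The exterior `E_K = S³ - Int N_K`. -/
def exterior : Set S3 := (interior K.nbhd)ᶜ

lemma boundary_subset_exterior : K.boundary ⊆ K.exterior := fun _ hx => hx.2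

/-- The inclusion of `∂N_K` into `E_K`. -/
def incl : C(K.boundary, K.exterior) :=
  ⟨inclusion K.boundary_subset_exterior, continuous_inclusion _⟩

lemma boundary_eq : K.boundary = K.tube '' (Metric.sphere 0 1 ×ˢ univ) := by
  have hcl : IsClosed K.nbhd :=
    (((isCompact_closedBall (0 : ℂ) 1).prod isCompact_univ).image
      K.isOpenEmbedding.continuous).isClosed
  have hN : K.tube ⁻¹' K.nbhd = Metric.closedBall 0 1 ×ˢ univ :=
    K.isOpenEmbedding.injective.preimage_image _
  have hfr : K.tube ⁻¹' K.boundary = Metric.sphere 0 1 ×ˢ univ := by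
    rw [boundary, K.isOpenEmbedding.isOpenMap.preimage_frontier_eq_frontier_preimage
      K.isOpenEmbedding.continuous, hN, frontier_prod_univ_eq, frontier_closedBall _ one_ne_zero]
  rw [← hfr, image_preimage_eq_of_subset]
  exact (hcl.frontier_subset).trans (image_subset_range _ _)

/-- The parametrisation of `∂N_K` by the torus: the first factor runs along the meridian circles
(the fibres of the normal circle bundle), the second along the knot. -/
noncomputable def torusMap (q : Torus) : K.boundary :=
  ⟨K.tube ((q.1 : ℂ), q.2), by
    rw [K.boundary_eq]
    exact mem_image_of_mem _ ⟨mem_sphere_zero_iff_norm.2 (Circle.norm_coe _), mem_univ _⟩⟩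

lemma torusMap_continuous : Continuous K.torusMap := by
  refine Continuous.subtype_mk (K.isOpenEmbedding.continuous.comp ?_) _
  fun_prop

lemma torusMap_bijective : Function.Bijective K.torusMap := by
  refine ⟨fun q r h => ?_, fun x => ?_⟩
  · have h' := K.isOpenEmbedding.injective (congrArg Subtype.val h)
    simp only [Prod.mk.injEq] at h'
    exact Prod.ext (Circle.ext h'.1) h'.2
  · obtain ⟨⟨u, w⟩, ⟨hu, -⟩, hx⟩ := K.boundary_eq.subset x.2
    exact ⟨(⟨u, by simpa [Submonoid.unitSphere] using hu⟩, w), Subtype.ext hx⟩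

/-- The identification of `∂N_K` with the torus `T²`. -/
noncomputable def torusHomeo : Torus ≃ₜ K.boundary :=
  K.torusMap_continuous.homeoOfEquivCompactToT2
    (f := Equiv.ofBijective K.torusMap K.torusMap_bijective)

/-- The meridian circle through `p ∈ ∂N_K`, positively oriented and starting at `p`. -/
noncomputable def meridianCircle (p : K.boundary) : C(Circle, K.boundary) :=
  ⟨fun v => K.torusHomeo ((K.torusHomeo.symm p).1 * v, (K.torusHomeo.symm p).2), by fun_prop⟩

lemma meridianCircle_one (p : K.boundary) : K.meridianCircle p 1 = p := by
  simp [meridianCircle]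

/-- The meridian loop `m_p` based at `p ∈ ∂N_K`, following the meridian circle through `p` once in
the positive direction. -/
noncomputable def meridian (p : K.boundary) : Path p p where
  toFun t := K.meridianCircle p (Circle.exp (2 * Real.pi * t))
  continuous_toFun := by fun_prop
  source' := by simp [meridianCircle_one]
  target' := by simp [meridianCircle_one]

/-! ### The fundamental quandle -/

/-- A path in `E_K` from a point of `∂N_K` to the basepoint `z`. -/
structure Arc (z : K.exterior) where
  /-- The initial point. -/
  start : K.boundary
  /-- The path. -/
  path : Path (K.incl start) z

variable {K} {z : K.exterior}

/-- Homotopy of arcs: the initial point may move on `∂N_K`, the final point is fixed. -/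
def Arc.Homotopic (a b : K.Arc z) : Prop :=
  ContinuousMap.HomotopicWith a.path.toContinuousMap b.path.toContinuousMap
    fun g => (g 0 : S3) ∈ K.boundary ∧ g 1 = z

lemma Arc.prop (a : K.Arc z) :
    (a.path.toContinuousMap 0 : S3) ∈ K.boundary ∧ a.path.toContinuousMap 1 = z := by
  refine ⟨?_, a.path.target⟩
  have : a.path.toContinuousMap 0 = K.incl a.start := a.path.source
  rw [this]
  exact a.start.2

/-- Homotopy of arcs is an equivalence relation. -/
instance arcSetoid (K : Knot) (z : K.exterior) : Setoid (K.Arc z) where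
  r := Arc.Homotopic
  iseqv :=
    ⟨fun a => ContinuousMap.HomotopicWith.refl _ a.prop, fun h => h.symm, fun h k => h.trans k⟩

/-- The underlying set `Γ_K` of the fundamental quandle `Q(K)`: homotopy classes of paths in `E_K`
from a point of `∂N_K` to the basepoint `z`. -/
def FundQuandle (K : Knot) (z : K.exterior) : Type := Quotient (arcSetoid K z)

/-- The class of an arc in `Q(K)`. -/
def FundQuandle.mk (a : K.Arc z) : FundQuandle K z := Quotient.mk _ a

lemma Arc.homotopic_iff (a b : K.Arc z) : a.Homotopic b ↔
    ∃ n : Path a.start b.start, a.path.Homotopic ((n.map K.incl.continuous).trans b.path) := by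
  constructor
  · rintro ⟨H⟩
    have hH0 : ∀ s, (H (s, 0) : S3) ∈ K.boundary := fun s => (H.prop s).1
    have hH1 : ∀ s, H (s, 1) = z := fun s => (H.prop s).2
    have e0 : H (0, 0) = K.incl a.start := (H.apply_zero 0).trans a.path.source
    have e1 : H (1, 0) = K.incl b.start := (H.apply_one 0).trans b.path.source
    let n : Path a.start b.start :=
      { toFun := fun s => ⟨H (s, 0), hH0 s⟩
        continuous_toFun := by
          refine Continuous.subtype_mk (continuous_subtype_val.comp ?_) _
          exact H.continuous.comp (by fun_prop)
        source' := Subtype.ext (congrArg (fun y : K.exterior => (y : S3)) e0)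
        target' := Subtype.ext (congrArg (fun y : K.exterior => (y : S3)) e1) }
    refine ⟨n, ?_⟩
    have key := (Path.Homotopic.map_trans_evalAt H.toHomotopy (Path.id)).pathCast
      a.path.source.symm b.path.target.symm
    have l1 : (((Path.id).map (map_continuous a.path.toContinuousMap)).trans
        (H.toHomotopy.evalAt 1)).cast a.path.source.symm b.path.target.symm
        = a.path.trans (Path.refl z) := by
      refine Path.ext (funext fun t => ?_)
      simp only [Path.cast_coe, Path.trans_apply]
      split_ifs with ht
      · rfl
      · exact hH1 _
    have l2 : ((H.toHomotopy.evalAt 0).trans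
        ((Path.id).map (map_continuous b.path.toContinuousMap))).cast
          a.path.source.symm b.path.target.symm
        = (n.map K.incl.continuous).trans b.path := by
      ext t
      simp only [Path.cast_coe, Path.trans_apply]
      split_ifs with ht <;> rfl
    rw [l1, l2] at key
    exact (Path.Homotopic.symm ⟨Path.Homotopy.transRefl a.path⟩).trans key
  · rintro ⟨n, ⟨F⟩⟩
    let c : K.Arc z := ⟨a.start, (n.map K.incl.continuous).trans b.path⟩
    have h1 : a.Homotopic c := by
      refine ⟨⟨F.toHomotopy, fun s => ⟨?_, ?_⟩⟩⟩
      · have : F (s, 0) = K.incl a.start := Path.Homotopy.source F s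
        change (F (s, 0) : S3) ∈ _
        rw [this]
        exact a.start.2
      · exact Path.Homotopy.target F s
    have h2 : c.Homotopic b := by
      let r : I × I → I := fun x => ⟨x.1 / 2 + (1 - x.1 / 2) * x.2, by
        have h1 := x.1.2.1
        have h2 := x.1.2.2
        have h3 := x.2.2.1
        have h4 := x.2.2.2
        constructor <;> nlinarith⟩
      have hr : Continuous r := by
        refine Continuous.subtype_mk ?_ _
        fun_prop
      refine ⟨⟨⟨⟨fun x => c.path (r x), c.path.continuous.comp hr⟩, fun t => ?_, fun t => ?_⟩,
        fun s => ⟨?_, ?_⟩⟩⟩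
      · change c.path (r (0, t)) = c.path t
        congr 1
        ext
        simp [r]
      · change c.path (r (1, t)) = b.path t
        simp only [c, Path.trans_apply]
        split_ifs with ht
        · have ht0 : t = 0 := by
            ext
            have h3 := t.2.1
            simp only [r, Icc.coe_one] at ht
            have : (t : ℝ) ≤ 0 := by linarith
            simpa using le_antisymm this h3
          subst ht0
          have : (⟨2 * (r (1, 0) : ℝ), by simp [r]⟩ : I) = 1 := by
            ext
            simp [r]
          rw [Path.source]
          exact (congrArg _ this).trans (Path.target _)
        · congr 1
          ext
          simp only [r, Icc.coe_one]
          ring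
      · change (c.path (r (s, 0)) : S3) ∈ K.boundary
        simp only [c, Path.trans_apply]
        rw [dif_pos (by
          have h2 := s.2.2
          simp only [r, Icc.coe_zero]
          linarith)]
        exact (n _).2
      · change c.path (r (s, 1)) = z
        have : r (s, 1) = 1 := by
          ext
          simp [r]
        rw [this]
        exact c.path.target
    exact h1.trans h2

lemma Arc.homotopic_iff' (a b : K.Arc z) : a.Homotopic b ↔
    ∃ n : Path a.start b.start,
      Path.Homotopic.Quotient.mk a.path = ((Path.Homotopic.Quotient.mk n).map K.incl).trans (Path.Homotopic.Quotient.mk b.path) := by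
  rw [Arc.homotopic_iff]
  refine exists_congr fun n => ?_
  rw [← Path.Homotopic.Quotient.eq, Path.Homotopic.Quotient.mk_trans, Path.Homotopic.Quotient.mk_map]

/-- The right action of `G_K = π₁(E_K, z)` on `Γ_K`, `[a]^[g] = [a · g]`. -/
noncomputable def FundQuandle.act (x : FundQuandle K z) (g : Path.Homotopic.Quotient z z) : FundQuandle K z :=
  Quotient.liftOn₂ x g (fun a g => FundQuandle.mk ⟨a.start, a.path.trans g⟩) (by
    intro a g b h hab hgh
    obtain ⟨n, hn⟩ := (Arc.homotopic_iff' a b).1 hab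
    refine Quotient.sound ((Arc.homotopic_iff' _ _).2 ⟨n, ?_⟩)
    have hgh' : Path.Homotopic.Quotient.mk g = Path.Homotopic.Quotient.mk h :=
      Path.Homotopic.Quotient.eq.2 hgh
    simp only [Path.Homotopic.Quotient.mk_trans, hn, hgh',
      Path.Homotopic.Quotient.trans_assoc])

/-- Transport of meridians along a path in `∂N_K`. -/
lemma meridian_trans {p q : K.boundary} (n : Path p q) :
    ((K.meridian p).trans n).Homotopic (n.trans (K.meridian q)) := by
  let M : (K.meridianCircle p).Homotopy (K.meridianCircle q) :=
    { toFun := fun x => K.meridianCircle (n x.1) x.2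
      continuous_toFun := by
        simp only [meridianCircle, ContinuousMap.coe_mk]
        fun_prop
      map_zero_left := fun v => by simp
      map_one_left := fun v => by simp }
  let e : Path (1 : Circle) 1 :=
    { toFun := fun t => Circle.exp (2 * Real.pi * t)
      continuous_toFun := by fun_prop
      source' := by simp
      target' := by simp }
  have key := (Path.Homotopic.map_trans_evalAt M e).pathCast
    (K.meridianCircle_one p).symm (K.meridianCircle_one q).symm
  have hM : ∀ t, M.evalAt 1 t = n t := fun t => K.meridianCircle_one (n t)
  have l1 : ((e.map (map_continuous (K.meridianCircle p))).trans (M.evalAt 1)).cast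
      (K.meridianCircle_one p).symm (K.meridianCircle_one q).symm
      = (K.meridian p).trans n := by
    ext t
    simp only [Path.cast_coe, Path.trans_apply]
    split_ifs with ht
    · rfl
    · rw [hM]
  have l2 : ((M.evalAt 1).trans (e.map (map_continuous (K.meridianCircle q)))).cast
      (K.meridianCircle_one p).symm (K.meridianCircle_one q).symm
      = n.trans (K.meridian q) := by
    ext t
    simp only [Path.cast_coe, Path.trans_apply]
    split_ifs with ht
    · rw [hM]
    · rfl
  rwa [l1, l2] at key

/-- The loop `b̄ · m_{b(0)} · b` at the basepoint. -/
noncomputable def Arc.loop (b : K.Arc z) : Path z z :=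
  b.path.symm.trans (((K.meridian b.start).map K.incl.continuous).trans b.path)

lemma Arc.loop_eq {a b : K.Arc z} (h : a.Homotopic b) :
    Path.Homotopic.Quotient.mk a.loop = Path.Homotopic.Quotient.mk b.loop := by
  obtain ⟨n, hn⟩ := (Arc.homotopic_iff' a b).1 h
  have hm : ((Path.Homotopic.Quotient.mk (K.meridian a.start)).map K.incl).trans ((Path.Homotopic.Quotient.mk n).map K.incl) =
      ((Path.Homotopic.Quotient.mk n).map K.incl).trans ((Path.Homotopic.Quotient.mk (K.meridian b.start)).map K.incl) := by
    have := Path.Homotopic.Quotient.eq.2 ((meridian_trans n).map K.incl)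
    rw [Path.map_trans, Path.map_trans] at this
    exact this
  have hs : (Path.Homotopic.Quotient.mk a.path).symm =
      (Path.Homotopic.Quotient.mk b.path).symm.trans ((Path.Homotopic.Quotient.mk n).map K.incl).symm := by
    have := congrArg Path.Homotopic.Quotient.symm hn
    rw [this, ← Path.Homotopic.Quotient.mk_map, ← Path.Homotopic.Quotient.mk_trans, ← Path.Homotopic.Quotient.mk_symm, Path.trans_symm]
    rfl
  simp only [Arc.loop, Path.Homotopic.Quotient.mk_trans, Path.Homotopic.Quotient.mk_symm, Path.Homotopic.Quotient.mk_map]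
  rw [hs, hn, Path.Homotopic.Quotient.trans_assoc, ← Path.Homotopic.Quotient.trans_assoc (Path.Homotopic.Quotient.map _ _) (Path.Homotopic.Quotient.map _ _),
    hm, Path.Homotopic.Quotient.trans_assoc, ← Path.Homotopic.Quotient.trans_assoc (Path.Homotopic.Quotient.symm (Path.Homotopic.Quotient.map _ _)),
    Path.Homotopic.Quotient.symm_trans, Path.Homotopic.Quotient.refl_trans]

/-- The augmentation `∂ : Γ_K → G_K`, `∂[b] = [b̄ · m_{b(0)} · b]`. -/
noncomputable def FundQuandle.bd (x : FundQuandle K z) : Path.Homotopic.Quotient z z :=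
  Quotient.liftOn x (fun b => Path.Homotopic.Quotient.mk b.loop) fun _ _ h => Arc.loop_eq h

namespace FundQuandle

lemma ind {P : FundQuandle K z → Prop} (h : ∀ a, P (mk a)) (x : FundQuandle K z) : P x :=
  _root_.Quotient.ind h x

lemma act_mk (a : K.Arc z) (g : Path z z) :
    act (mk a) (Path.Homotopic.Quotient.mk g) = mk ⟨a.start, a.path.trans g⟩ := rfl

lemma bd_mk (b : K.Arc z) : bd (mk b) = Path.Homotopic.Quotient.mk b.loop := rfl

lemma mk_eq_iff (a b : K.Arc z) : mk a = mk b ↔ a.Homotopic b := _root_.Quotient.eq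

lemma mk_eq_of_path {p : K.boundary} {a b : Path (K.incl p) z}
    (h : Path.Homotopic.Quotient.mk a = Path.Homotopic.Quotient.mk b) :
    (mk ⟨p, a⟩ : FundQuandle K z) = mk ⟨p, b⟩ := by
  rw [mk_eq_iff, Arc.homotopic_iff']
  refine ⟨Path.refl p, ?_⟩
  rw [← Path.Homotopic.Quotient.mk_map]
  change Path.Homotopic.Quotient.mk a = (Path.Homotopic.Quotient.refl _).trans (Path.Homotopic.Quotient.mk b)
  rw [h, Path.Homotopic.Quotient.refl_trans]

lemma act_trans (x : FundQuandle K z) (g h : Path.Homotopic.Quotient z z) :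
    act x (g.trans h) = act (act x g) h := by
  induction x using ind with | h a =>
  induction g with | mk g =>
  induction h with | mk h =>
  rw [← Path.Homotopic.Quotient.mk_trans, act_mk, act_mk, act_mk]
  apply mk_eq_of_path
  simp only [Path.Homotopic.Quotient.mk_trans, Path.Homotopic.Quotient.trans_assoc]

lemma act_refl (x : FundQuandle K z) : act x (Path.Homotopic.Quotient.refl z) = x := by
  induction x using ind with | h a =>
  rw [← Path.Homotopic.Quotient.mk_refl, act_mk]
  apply mk_eq_of_path
  simp only [Path.Homotopic.Quotient.mk_trans, Path.Homotopic.Quotient.mk_refl, Path.Homotopic.Quotient.trans_refl]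

/-- First augmentation condition: `x^{∂x} = x`. -/
lemma act_bd_self (x : FundQuandle K z) : act x (bd x) = x := by
  induction x using ind with | h a =>
  rw [bd_mk, act_mk, mk_eq_iff, Arc.homotopic_iff']
  refine ⟨K.meridian a.start, ?_⟩
  simp only [Arc.loop, Path.Homotopic.Quotient.mk_trans, Path.Homotopic.Quotient.mk_symm, Path.Homotopic.Quotient.mk_map]
  rw [← Path.Homotopic.Quotient.trans_assoc, Path.Homotopic.Quotient.trans_symm, Path.Homotopic.Quotient.refl_trans]

/-- Second augmentation condition: `∂(x^g) = g⁻¹ (∂x) g`. -/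
lemma bd_act (x : FundQuandle K z) (g : Path.Homotopic.Quotient z z) :
    bd (act x g) = g.symm.trans ((bd x).trans g) := by
  induction x using ind with | h a =>
  induction g with | mk g =>
  rw [act_mk, bd_mk, bd_mk]
  simp only [Arc.loop, Path.trans_symm, Path.Homotopic.Quotient.mk_trans, Path.Homotopic.Quotient.mk_symm,
    Path.Homotopic.Quotient.trans_assoc]

/-- The fundamental quandle. In the notation of right actions, `y ◃ x` is `x ▷ y = x^{∂y}` and
`y ◃⁻¹ x` is `x ◁ y = x^{(∂y)⁻¹}`. -/
noncomputable instance : Quandle (FundQuandle K z) where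
  act y x := act x (bd y)
  invAct y x := act x (bd y).symm
  self_distrib := by
    intro x y w
    rw [bd_act, ← act_trans, ← act_trans, ← Path.Homotopic.Quotient.trans_assoc, Path.Homotopic.Quotient.trans_symm,
      Path.Homotopic.Quotient.refl_trans]
  left_inv := fun y x => by
    beta_reduce
    rw [← act_trans, Path.Homotopic.Quotient.trans_symm, act_refl]
  right_inv := fun y x => by
    beta_reduce
    rw [← act_trans, Path.Homotopic.Quotient.symm_trans, act_refl]
  fix := act_bd_self _

/-- `x ▷ y = x^{∂y}`; on representatives, `[a] ▷ [b] = [a · b̄ · m_{b(0)} · b]`. -/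
noncomputable def tr (x y : FundQuandle K z) : FundQuandle K z := y ◃ x

/-- `x ◁ y = x^{(∂y)⁻¹}`. -/
noncomputable def tl (x y : FundQuandle K z) : FundQuandle K z := y ◃⁻¹ x

/-- A quandle automorphism of `Q(K)`. -/
def IsAut (F : FundQuandle K z → FundQuandle K z) : Prop :=
  Function.Bijective F ∧ ∀ x y, F (tr x y) = tr (F x) (F y)

/-- A quandle antiautomorphism of `Q(K)`. -/
def IsAntiAut (F : FundQuandle K z → FundQuandle K z) : Prop :=
  Function.Bijective F ∧ ∀ x y, F (tr x y) = tl (F x) (F y)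

end FundQuandle

/-! ### Homeomorphisms preserving the regular neighbourhood -/

variable (K)

/-- The restriction of a homeomorphism with `f(N_K) = N_K` to the boundary torus. -/
def boundaryHomeo (f : S3 ≃ₜ S3) (hN : f '' K.nbhd = K.nbhd) : K.boundary ≃ₜ K.boundary :=
  f.subtype fun x => by
    have h : f '' K.boundary = K.boundary := by rw [boundary, f.image_frontier, hN]
    refine ⟨fun hx => h ▸ mem_image_of_mem f hx, fun hx => ?_⟩
    change f x ∈ K.boundary at hx
    rw [← h] at hx
    exact f.injective.mem_set_image.1 hx

/-- The restriction of a homeomorphism with `f(N_K) = N_K` to the exterior. -/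
def exteriorHomeo (f : S3 ≃ₜ S3) (hN : f '' K.nbhd = K.nbhd) : K.exterior ≃ₜ K.exterior :=
  f.subtype fun x => by
    have h : f '' interior K.nbhd = interior K.nbhd := by rw [f.image_interior, hN]
    change x ∉ interior K.nbhd ↔ f x ∉ interior K.nbhd
    rw [← f.injective.mem_set_image (s := interior K.nbhd), h]

/-- The mapping class `[f|_{∂N_K}] ∈ MCG(T²)`. -/
noncomputable def boundaryClass (f : S3 ≃ₜ S3) (hN : f '' K.nbhd = K.nbhd) : MCG Torus :=
  MCG.mk ((K.torusHomeo.trans (K.boundaryHomeo f hN)).trans K.torusHomeo.symm)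

/-- The positively oriented meridian circle through `p`, as a map into the 3-sphere. -/
noncomputable def posMeridian (p : K.boundary) : C(Circle, S3) :=
  ⟨fun v => K.meridianCircle p v,
    continuous_subtype_val.comp (K.meridianCircle p).continuous⟩

/-- The negatively oriented meridian circle through `p`, as a map into the 3-sphere. -/
noncomputable def negMeridian (p : K.boundary) : C(Circle, S3) :=
  ⟨fun v => K.meridianCircle p v⁻¹,
    continuous_subtype_val.comp ((K.meridianCircle p).continuous.comp continuous_inv)⟩

/-- Free homotopy of loops in the punctured neighbourhood `N_K - K`. -/
def FreelyHomotopic (c d : C(Circle, S3)) : Prop :=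
  ContinuousMap.HomotopicWith c d fun g => ∀ v, g v ∈ K.nbhd \ K.carrier

/-- `f` preserves the orientation of the normal bundle: it carries positively oriented meridians to
loops around `K` that are freely homotopic in `N_K - K` to positively oriented meridians. -/
def PreservesNormalOrientation (f : S3 ≃ₜ S3) : Prop :=
  ∀ p q : K.boundary, K.FreelyHomotopic ((f : C(S3, S3)).comp (K.posMeridian p)) (K.posMeridian q)

/-- `f` reverses the orientation of the normal bundle. -/
def ReversesNormalOrientation (f : S3 ≃ₜ S3) : Prop :=
  ∀ p q : K.boundary, K.FreelyHomotopic ((f : C(S3, S3)).comp (K.posMeridian p)) (K.negMeridian q)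

variable {K} {z : K.exterior}

/-- The image `f ∘ a` of an arc, extended by a path `γ` in `E_K` from `f(z)` back to the
basepoint `z`. -/
noncomputable def Arc.image (f : S3 ≃ₜ S3) (hN : f '' K.nbhd = K.nbhd) (γ : Path (K.exteriorHomeo f hN z) z)
    (a : K.Arc z) : K.Arc z :=
  ⟨K.boundaryHomeo f hN a.start, (a.path.map (K.exteriorHomeo f hN).continuous).trans γ⟩

/-- The image `f ∘ a` of an arc, if `f` fixes the basepoint. -/
def Arc.image₀ (f : S3 ≃ₜ S3) (hN : f '' K.nbhd = K.nbhd) (hz : K.exteriorHomeo f hN z = z)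
    (a : K.Arc z) : K.Arc z :=
  ⟨K.boundaryHomeo f hN a.start,
    (a.path.map (K.exteriorHomeo f hN).continuous).cast rfl hz.symm⟩

end Knot

/-! ### Loops in the punctured plane -/

/-! The knot group acts on `Q(K)` with `x ▷ y = x^{∂y}`, where `∂[b]` is the conjugate of the
meridian at `b(0)` by `b`. A path `γ` from `f(z)` to `z` gives a map `loopMap` on the knot group,
and `f_*` is equivariant along it (`map_act`). Everything thus reduces to comparing `loopMap (∂y)`
with `∂(f_* y)`, that is, `f ∘ m_p` with `m_{f(p)}`.

This comparison takes place in the boundary torus. The mapping class hypothesis makes `f|∂N_K`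
homotopic to the identity or to the inversion. Such a homotopy determines `f ∘ m_p` up to
conjugation by the track of `p`, and meridians slide along any path in the torus, so `f ∘ m_p` is
homotopic to `m_{f(p)}` or to its inverse rel endpoints. Bijectivity holds because `f` and `γ` can
be undone.

The sign must also agree with the orientation condition on `f`. A winding number argument
(`not_homotopic_reverse_circle`) shows that positive and negative meridians are not freely homotopic
in `N_K - K`, so the two conditions exclude each other. -/

/-- A continuous function on the line whose exponential is constant is constant. -/
lemma eq_of_exp_comp_eq {k : ℝ → ℂ} (hk : Continuous k)
    (h : ∀ s t, Complex.exp (k s) = Complex.exp (k t)) (s t : ℝ) : k s = k t :=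
  Complex.isCoveringMap_exp.const_of_comp hk (fun a b => Subtype.ext (h a b)) s t

/-- A circle in the punctured plane is not freely homotopic to its reverse. -/
lemma not_homotopic_reverse_circle (u : Circle) (h : I × Circle → ℂ) (hc : Continuous h)
    (h0 : ∀ x, h x ≠ 0) (hpos : ∀ v : Circle, h (0, v) = u * v)
    (hneg : ∀ v : Circle, h (1, v) = u * (v⁻¹ : Circle)) : False := by
  -- Clamping the time and unrolling the circle gives a simply connected domain, on which a
  -- logarithm `F` of `h` exists.
  let g : C(ℝ × ℝ, ℂ) := ⟨fun x => h (projIcc 0 1 zero_le_one x.1, Circle.exp x.2), by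
    refine hc.comp (Continuous.prodMk (continuous_projIcc.comp continuous_fst) (by fun_prop))⟩
  obtain ⟨F, ⟨-, hF⟩, -⟩ := Complex.isCoveringMapOn_exp.existsUnique_continuousMap_lifts g
    (a₀ := (0, 0)) (Complex.exp_log (h0 _)) (fun a => h0 _)
  have hF' : ∀ s t, Complex.exp (F (s, t)) = h (projIcc 0 1 zero_le_one s, Circle.exp t) :=
    fun s t => congrFun hF (s, t)
  -- The increment of `F` around the circle is `2πi` times the winding number, hence independent of
  -- the time.
  have hconst := eq_of_exp_comp_eq (k := fun s => F (s, 2 * Real.pi) - F (s, 0)) (by fun_prop)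
    (fun s t => by
      simp only [Complex.exp_sub, hF', Circle.exp_two_pi, Circle.exp_zero]
      rw [div_self (h0 _), div_self (h0 _)]) 0 1
  -- The increment is `2πi` at time 0 and `-2πi` at time 1.
  have e0 := eq_of_exp_comp_eq (k := fun t => F (0, t) - t * Complex.I) (by fun_prop)
    (fun s t => by
      simp [Complex.exp_sub, hF', hpos, Complex.exp_ne_zero]) 0 (2 * Real.pi)
  have e1 := eq_of_exp_comp_eq (k := fun t => F (1, t) + t * Complex.I) (by fun_prop)
    (fun s t => by
      simp [Complex.exp_add, hF', hneg, Complex.exp_ne_zero]) 0 (2 * Real.pi)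
  simp only [Complex.ofReal_zero, zero_mul, sub_zero, add_zero] at hconst e0 e1
  rw [e0, e1] at hconst
  have h4 : (4 * Real.pi : ℂ) * Complex.I = 0 := by
    push_cast at hconst
    linear_combination hconst
  simp [Real.pi_ne_zero] at h4

/-! ### Homotopy classes of paths -/

namespace Path.Homotopic.Quotient

variable {X Y : Type*} [TopologicalSpace X] [TopologicalSpace Y] {x y w : X}

lemma trans_left_cancel {p : Path.Homotopic.Quotient x y} {q r : Path.Homotopic.Quotient y w}
    (h : p.trans q = p.trans r) : q = r := by
  have := congrArg p.symm.trans h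
  rwa [← trans_assoc, ← trans_assoc, symm_trans, refl_trans, refl_trans] at this

lemma trans_right_cancel {p q : Path.Homotopic.Quotient x y} {r : Path.Homotopic.Quotient y w}
    (h : p.trans r = q.trans r) : p = q := by
  have := congrArg (fun s => s.trans r.symm) h
  simpa only [trans_assoc, trans_symm, trans_refl] using this

lemma map_trans (p : Path.Homotopic.Quotient x y) (q : Path.Homotopic.Quotient y w) (f : C(X, Y)) :
    (p.trans q).map f = (p.map f).trans (q.map f) := by
  induction p with | mk p =>
  induction q with | mk q =>
  rw [← mk_trans, ← mk_map, Path.map_trans]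
  rfl

lemma map_symm (p : Path.Homotopic.Quotient x y) (f : C(X, Y)) :
    p.symm.map f = (p.map f).symm := by
  induction p with | mk p =>
  rw [← mk_symm, ← mk_map, ← mk_map, ← mk_symm, Path.map_symm]

lemma trans_symm_rev (p : Path.Homotopic.Quotient x y) (q : Path.Homotopic.Quotient y w) :
    (p.trans q).symm = q.symm.trans p.symm := by
  induction p with | mk p =>
  induction q with | mk q =>
  rw [← mk_trans, ← mk_symm, Path.trans_symm, mk_trans, mk_symm, mk_symm]

/-- The final path `r` cancels on the right. With its converse `map_trans_eq_of_eq`, this serves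
`image_homotopic_iff`, where `r` is the class of `γ`. -/
lemma map_eq_of_trans_eq {f : C(X, Y)} {v : Y} {p : Path.Homotopic.Quotient x w}
    {n : Path.Homotopic.Quotient x y} {q : Path.Homotopic.Quotient y w}
    {r : Path.Homotopic.Quotient (f w) v}
    (h : (p.map f).trans r = (n.map f).trans ((q.map f).trans r)) :
    p.map f = (n.trans q).map f := by
  rw [← trans_assoc] at h
  rw [trans_right_cancel h, map_trans]

lemma map_trans_eq_of_eq (f : C(X, Y)) {v : Y} {p : Path.Homotopic.Quotient x w}
    {n : Path.Homotopic.Quotient x y} {q : Path.Homotopic.Quotient y w}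
    (r : Path.Homotopic.Quotient (f w) v) (h : p = n.trans q) :
    (p.map f).trans r = (n.map f).trans ((q.map f).trans r) := by
  rw [h, map_trans, trans_assoc]

/-- Inserting `r · r̄` in the middle turns the action of `g` into the action of its transported
loop. -/
lemma map_trans_trans (f : C(X, Y)) {v : Y} (p : Path.Homotopic.Quotient x y)
    (g : Path.Homotopic.Quotient y y) (r : Path.Homotopic.Quotient (f y) v) :
    ((p.trans g).map f).trans r =
      ((p.map f).trans r).trans (r.symm.trans ((g.map f).trans r)) := by
  rw [map_trans, trans_assoc, trans_assoc, ← trans_assoc r, trans_symm, refl_trans]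

lemma map_conj (f : C(X, Y)) {v : Y} (p : Path.Homotopic.Quotient x y)
    (m : Path.Homotopic.Quotient x x) (r : Path.Homotopic.Quotient (f y) v) :
    r.symm.trans (((p.symm.trans (m.trans p)).map f).trans r) =
      ((p.map f).trans r).symm.trans ((m.map f).trans ((p.map f).trans r)) := by
  simp only [trans_symm_rev, map_trans, map_symm, trans_assoc]

lemma conj_map_symm (f : C(X, Y)) {v : Y} (p : Path.Homotopic.Quotient (f x) v)
    (m : Path.Homotopic.Quotient x x) :
    p.symm.trans ((m.symm.map f).trans p) = (p.symm.trans ((m.map f).trans p)).symm := by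
  have : p.symm.symm = p := by
    induction p with | mk p =>
    rw [← mk_symm, ← mk_symm, Path.symm_symm]
  rw [trans_symm_rev, trans_symm_rev, this, map_symm, trans_assoc]

lemma map_injective (e : X ≃ₜ Y) :
    Function.Injective fun p : Path.Homotopic.Quotient x y => p.map (e : C(X, Y)) := by
  intro p q h
  induction p with | mk p =>
  induction q with | mk q =>
  have h' := (Path.Homotopic.Quotient.exact h).map (e.symm : C(Y, X))
  have h'' := h'.pathCast (e.symm_apply_apply x).symm (e.symm_apply_apply y).symm
  refine Path.Homotopic.Quotient.eq.2 ?_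
  convert h'' using 1 <;> ext t <;> simp

end Path.Homotopic.Quotient

lemma Homeomorph.exists_path_map_eq {X Y : Type*} [TopologicalSpace X] [TopologicalSpace Y]
    (e : X ≃ₜ Y) {x y : X} (p : Path (e x) (e y)) : ∃ q : Path x y, q.map e.continuous = p :=
  ⟨(p.map e.symm.continuous).cast (e.symm_apply_apply x).symm (e.symm_apply_apply y).symm,
    by ext t; simp⟩

namespace Knot

variable {K : Knot} {z : K.exterior}

/-! ### The exterior is path connected -/

lemma isClosed_nbhd : IsClosed K.nbhd :=
  (((isCompact_closedBall (0 : ℂ) 1).prod isCompact_univ).image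
    K.isOpenEmbedding.continuous).isClosed

lemma tube_mem_exterior {v : ℂ} {w : Circle} : K.tube (v, w) ∈ K.exterior ↔ 1 ≤ ‖v‖ := by
  have h : K.tube ⁻¹' interior K.nbhd = Metric.ball 0 1 ×ˢ univ := by
    rw [K.isOpenEmbedding.isOpenMap.preimage_interior_eq_interior_preimage
      K.isOpenEmbedding.continuous, nbhd, K.isOpenEmbedding.injective.preimage_image,
      interior_prod_eq, interior_univ, interior_closedBall _ one_ne_zero]
  have h' : K.tube (v, w) ∈ interior K.nbhd ↔ ‖v‖ < 1 := by
    rw [← mem_preimage, h]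
    simp
  rw [exterior, mem_compl_iff, h', not_lt]

/-- The part of the exterior inside the tube is path connected. -/
lemma joinedIn_tube {v v' : ℂ} {w w' : Circle} (hv : 1 ≤ ‖v‖) (hv' : 1 ≤ ‖v'‖) :
    JoinedIn K.exterior (K.tube (v, w)) (K.tube (v', w')) := by
  have hA : IsPathConnected ((Metric.ball (0 : ℂ) 1)ᶜ ×ˢ (univ : Set Circle)) := by
    -- Polar coordinates, with radius `1 + |r|`, present the set as a continuous image of `ℝ³`.
    have : (Metric.ball (0 : ℂ) 1)ᶜ ×ˢ (univ : Set Circle) =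
        (fun x : ℝ × ℝ × ℝ =>
          ((((1 + |x.1|) : ℝ) : ℂ) * Circle.exp x.2.1, Circle.exp x.2.2)) '' univ := by
      ext ⟨a, b⟩
      simp only [mem_prod, mem_compl_iff, Metric.mem_ball, dist_zero_right, not_lt, mem_univ,
        and_true, image_univ, mem_range, Prod.exists, Prod.mk.injEq]
      constructor
      · intro ha
        refine ⟨‖a‖ - 1, a.arg, (b : ℂ).arg, ?_, Circle.exp_arg b⟩
        rw [abs_of_nonneg (by linarith), Circle.coe_exp, add_sub_cancel]
        exact Complex.norm_mul_exp_arg_mul_I a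
      · rintro ⟨r, s, t, rfl, -⟩
        rw [norm_mul, Circle.norm_coe, Complex.norm_real, mul_one]
        exact le_trans (by simp) (le_abs_self _)
    rw [this]
    refine IsPathConnected.image isPathConnected_univ ?_
    fun_prop
  refine ((hA.image K.isOpenEmbedding.continuous).joinedIn _
    (mem_image_of_mem _ (by simpa using hv)) _ (mem_image_of_mem _ (by simpa using hv'))).mono ?_
  rintro _ ⟨⟨a, b⟩, ⟨ha, -⟩, rfl⟩
  exact tube_mem_exterior.2 (by simpa using ha)

instance : LocallyPathConnectedSpace S3 :=
  haveI : Fact (Module.finrank ℝ (EuclideanSpace ℝ (Fin 4)) = 3 + 1) := ⟨by simp⟩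
  ChartedSpace.locallyPathConnectedSpace (EuclideanSpace ℝ (Fin 3)) S3

instance : PreconnectedSpace S3 :=
  isPreconnected_iff_preconnectedSpace.1 (isPreconnected_sphere (by
    rw [rank_eq_card_basis (EuclideanSpace.basisFun (Fin 4) ℝ).toBasis]
    simp) 0 1)

/-- Only the connectedness of the sphere and of the part of `E_K` inside the tube is needed: any
point near `N_K` reaches that part, and being joined to it is an open and closed condition. -/
lemma exterior_joinedIn {x y : S3} (hx : x ∈ K.exterior) (hy : y ∈ K.exterior) :
    JoinedIn K.exterior x y := by
  suffices H : ∀ x ∈ K.exterior, JoinedIn K.exterior (K.tube (1, 1)) x from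
    (H x hx).symm.trans (H y hy)
  -- Points of `Int N_K` lie in `C` vacuously, so `C` contains the whole tube and can be clopen in
  -- the sphere.
  let C : Set S3 := {x | x ∈ K.exterior → JoinedIn K.exterior (K.tube (1, 1)) x}
  have htube : range K.tube ⊆ C := by
    rintro _ ⟨⟨v, w⟩, rfl⟩ h
    exact joinedIn_tube (by simp) (tube_mem_exterior.1 h)
  have hloc : ∀ x, ∃ U ∈ nhds x, U ⊆ C ∨ U ⊆ Cᶜ := by
    intro x
    by_cases hxr : x ∈ K.nbhd
    · exact ⟨range K.tube, K.isOpenEmbedding.isOpen_range.mem_nhds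
        (image_subset_range _ _ hxr), Or.inl htube⟩
    · have hUo : K.nbhdᶜ ∈ nhds x := isClosed_nbhd.isOpen_compl.mem_nhds hxr
      -- Off `N_K`, a path connected neighbourhood inside `E_K` lies wholly in `C` or wholly outside
      -- it.
      obtain ⟨U, ⟨hU, hUc⟩, hUN⟩ := (LocallyPathConnectedSpace.path_connected_basis x).mem_iff.1 hUo
      have hUE : U ⊆ K.exterior := fun y hy h => hUN hy (interior_subset h)
      refine ⟨U, hU, ?_⟩
      have hxU := mem_of_mem_nhds hU
      have hj : ∀ y ∈ U, JoinedIn K.exterior x y := fun y hy =>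
        (hUc.joinedIn x hxU y hy).mono hUE
      by_cases hxC : x ∈ C
      · exact Or.inl fun y hy _ => (hxC (hUE hxU)).trans (hj y hy)
      · refine Or.inr fun y hy hyC => hxC fun _ => (hyC (hUE hy)).trans (hj y hy).symm
  have hopen : IsOpen C := isOpen_iff_mem_nhds.2 fun x hx => by
    obtain ⟨U, hU, h | h⟩ := hloc x
    · exact Filter.mem_of_superset hU h
    · exact absurd hx (h (mem_of_mem_nhds hU))
  have hclosed : IsClosed C := isOpen_compl_iff.1 <| isOpen_iff_mem_nhds.2 fun x hx => by
    obtain ⟨U, hU, h | h⟩ := hloc x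
    · exact absurd (h (mem_of_mem_nhds hU)) hx
    · exact Filter.mem_of_superset hU h
  have huniv : C = univ := IsClopen.eq_univ ⟨hclosed, hopen⟩ ⟨_, htube ⟨(1, 1), rfl⟩⟩
  intro x hx
  exact (huniv ▸ mem_univ x : x ∈ C) hx

lemma exterior_joined (x y : K.exterior) : Joined x y :=
  joinedIn_iff_joined x.2 y.2 |>.1 (exterior_joinedIn x.2 y.2)

/-! ### The restriction to the boundary torus up to homotopy -/

/-- The homotopy from the identity traced by an isotopy. -/
lemma _root_.IsotopicToId.homotopic {X : Type*} [TopologicalSpace X] {g : X ≃ₜ X}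
    (h : IsotopicToId g) : (ContinuousMap.id X).Homotopic (g : C(X, X)) := by
  obtain ⟨Φ, -, h0, h1⟩ := h
  exact ⟨{
    toFun := fun x => (Φ x).2
    continuous_toFun := by fun_prop
    map_zero_left := fun x => by simp [h0]
    map_one_left := fun x => by simp [h1] }⟩

variable (K) in
/-- The involution of `∂N_K` corresponding to `(u, w) ↦ (u⁻¹, w⁻¹)`. -/
noncomputable def boundaryInv : C(K.boundary, K.boundary) :=
  ⟨fun p => K.torusHomeo (K.torusHomeo.symm p)⁻¹, by fun_prop⟩

lemma boundaryInv_meridianCircle (p : K.boundary) (v : Circle) :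
    K.boundaryInv (K.meridianCircle p v) = K.meridianCircle (K.boundaryInv p) v⁻¹ := by
  simp [boundaryInv, meridianCircle, mul_comm]

lemma boundaryHomeo_homotopic_id {f : S3 ≃ₜ S3} {hN : f '' K.nbhd = K.nbhd}
    (h : K.boundaryClass f hN = 1) :
    (K.boundaryHomeo f hN : C(K.boundary, K.boundary)).Homotopic (ContinuousMap.id _) := by
  have h1 : IsotopicToId ((K.torusHomeo.trans (K.boundaryHomeo f hN)).trans K.torusHomeo.symm) :=
    (QuotientGroup.eq_one_iff _).1 h
  have h2 := (ContinuousMap.Homotopic.refl (K.torusHomeo : C(Torus, K.boundary))).comp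
    (h1.homotopic.symm.comp (ContinuousMap.Homotopic.refl (K.torusHomeo.symm : C(K.boundary, Torus))))
  convert h2 using 1 <;> ext p <;> simp

/-- Equality of cosets only says that `g⁻¹ ∘ inv` is isotopic to the identity; composing with `g` on
the left gives the homotopy from `g` to `inv`. -/
lemma boundaryHomeo_homotopic_boundaryInv {f : S3 ≃ₜ S3} {hN : f '' K.nbhd = K.nbhd}
    (h : K.boundaryClass f hN = MCG.negOne) :
    (K.boundaryHomeo f hN : C(K.boundary, K.boundary)).Homotopic K.boundaryInv := by
  have h1 : IsotopicToId (((K.torusHomeo.trans (K.boundaryHomeo f hN)).trans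
      K.torusHomeo.symm)⁻¹ * Homeomorph.inv Torus) := QuotientGroup.eq.1 h
  have h2 := (ContinuousMap.Homotopic.refl
    ((K.torusHomeo.trans (K.boundaryHomeo f hN) : Torus ≃ₜ K.boundary) : C(Torus, K.boundary))).comp
    (h1.homotopic.comp (ContinuousMap.Homotopic.refl (K.torusHomeo.symm : C(K.boundary, Torus))))
  convert h2 using 1
  · ext p
    simp
  · refine ContinuousMap.ext fun p => ?_
    change _ = K.boundaryHomeo f hN (K.torusHomeo (K.torusHomeo.symm
      ((K.boundaryHomeo f hN).symm (K.torusHomeo (K.torusHomeo.symm p)⁻¹))))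
    simp [boundaryInv]

/-! ### Orientation of the normal bundle -/

lemma boundary_subset_punctured : K.boundary ⊆ K.nbhd \ K.carrier := by
  rw [boundary_eq]
  rintro _ ⟨⟨v, w⟩, ⟨hv, -⟩, rfl⟩
  refine ⟨mem_image_of_mem _ ⟨Metric.sphere_subset_closedBall hv, mem_univ _⟩, ?_⟩
  rw [← K.image_core, K.isOpenEmbedding.injective.mem_set_image]
  rintro ⟨rfl, -⟩
  simp at hv

lemma freelyHomotopic_of_homotopic {c d : C(Circle, K.boundary)} (h : c.Homotopic d)
    {c' d' : C(Circle, S3)} (hc : ∀ v, c' v = c v) (hd : ∀ v, d' v = d v) :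
    K.FreelyHomotopic c' d' := by
  obtain ⟨H⟩ := h
  exact ⟨{
    toFun := fun x => H x
    continuous_toFun := by fun_prop
    map_zero_left := fun v => by simp [hc]
    map_one_left := fun v => by simp [hd]
    prop' := fun t v => boundary_subset_punctured (H (t, v)).2 }⟩

lemma boundary_joined (p q : K.boundary) : Joined p q := by
  obtain ⟨x, rfl⟩ := K.torusHomeo.surjective p
  obtain ⟨y, rfl⟩ := K.torusHomeo.surjective q
  exact ⟨(PathConnectedSpace.somePath x y).map K.torusHomeo.continuous⟩

/-- The trivialisation lets a meridian slide along a path of base points, so orientation does not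
depend on the chosen meridians. -/
lemma meridianCircle_homotopic (p q : K.boundary) :
    (K.meridianCircle p).Homotopic (K.meridianCircle q) := by
  obtain ⟨n⟩ := boundary_joined p q
  exact ⟨{
    toFun := fun x => K.meridianCircle (n x.1) x.2
    continuous_toFun := by
      simp only [meridianCircle, ContinuousMap.coe_mk]
      fun_prop
    map_zero_left := fun v => by simp
    map_one_left := fun v => by simp }⟩

lemma preservesNormalOrientation_of_homotopic {f : S3 ≃ₜ S3} {hN : f '' K.nbhd = K.nbhd}
    (h : (K.boundaryHomeo f hN : C(K.boundary, K.boundary)).Homotopic (ContinuousMap.id _)) :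
    K.PreservesNormalOrientation f := fun p q =>
  freelyHomotopic_of_homotopic
    ((h.comp (ContinuousMap.Homotopic.refl (K.meridianCircle p))).trans
      (meridianCircle_homotopic p q)) (fun _ => rfl) (fun _ => rfl)

lemma reversesNormalOrientation_of_homotopic {f : S3 ≃ₜ S3} {hN : f '' K.nbhd = K.nbhd}
    (h : (K.boundaryHomeo f hN : C(K.boundary, K.boundary)).Homotopic K.boundaryInv) :
    K.ReversesNormalOrientation f := fun p q => by
  have h1 : (K.boundaryInv.comp (K.meridianCircle p)).Homotopic
      ((K.meridianCircle q).comp ⟨fun v : Circle => v⁻¹, continuous_inv⟩) := by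
    have := (meridianCircle_homotopic (K.boundaryInv p) q).comp
      (ContinuousMap.Homotopic.refl ⟨fun v : Circle => v⁻¹, continuous_inv⟩)
    convert this using 1
    exact ContinuousMap.ext fun v => boundaryInv_meridianCircle p v
  exact freelyHomotopic_of_homotopic
    ((h.comp (ContinuousMap.Homotopic.refl (K.meridianCircle p))).trans h1)
    (fun _ => rfl) (fun _ => rfl)

/-- In tube coordinates, projection to `ℂ` sends `N_K - K` into the punctured plane and the two
meridians to `u v` and `u v⁻¹`. -/
lemma not_freelyHomotopic_pos_neg (p : K.boundary) :
    ¬ K.FreelyHomotopic (K.posMeridian p) (K.negMeridian p) := by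
  rintro ⟨H⟩
  have hmem : ∀ x, H x ∈ K.nbhd \ K.carrier := fun x => H.prop x.1 x.2
  have hr : ∀ x, H x ∈ range K.tube := fun x => image_subset_range _ _ (hmem x).1
  let e := K.isOpenEmbedding.toIsEmbedding.toHomeomorph
  let h : I × Circle → ℂ := fun x => (e.symm ⟨H x, hr x⟩).1
  have he : ∀ x y, H x = K.tube y → h x = y.1 := by
    intro x y hxy
    have : (⟨H x, hr x⟩ : range K.tube) = e y := Subtype.ext hxy
    simp [h, this]
  refine not_homotopic_reverse_circle (K.torusHomeo.symm p).1 h ?_ (fun x hx => ?_)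
    (fun v => ?_) (fun v => ?_)
  · exact continuous_fst.comp (e.symm.continuous.comp (H.continuous.subtype_mk _))
  · obtain ⟨⟨a, b⟩, hy⟩ := hr x
    have ha : a = 0 := (he x (a, b) hy.symm).symm.trans hx
    subst ha
    refine (hmem x).2 ?_
    rw [← hy, ← K.image_core]
    exact mem_image_of_mem _ ⟨rfl, mem_univ _⟩
  · rw [he (0, v) (((K.torusHomeo.symm p).1 * v : Circle), (K.torusHomeo.symm p).2)]
    · simp
    · exact H.apply_zero v
  · rw [he (1, v) (((K.torusHomeo.symm p).1 * v⁻¹ : Circle), (K.torusHomeo.symm p).2)]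
    · simp
    · exact H.apply_one v

lemma not_preserves_and_reverses {f : S3 ≃ₜ S3} (hp : K.PreservesNormalOrientation f)
    (hr : K.ReversesNormalOrientation f) : False :=
  let p := K.torusHomeo (1, 1)
  not_freelyHomotopic_pos_neg p ((hp p p).symm.trans (hr p p))

/-! ### Images of meridian loops -/

lemma meridian_trans_quotient {p q : K.boundary} (n : Path p q) :
    (Path.Homotopic.Quotient.mk (K.meridian p)).trans (.mk n) = (Path.Homotopic.Quotient.mk n).trans (.mk (K.meridian q)) :=
  Path.Homotopic.Quotient.eq.2 (meridian_trans n)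

/-- The homotopy yields equality up to conjugation by the track of `p`; the meridian slides along
that track, which removes the conjugation. -/
lemma map_meridian_of_homotopic_id {g : C(K.boundary, K.boundary)}
    (h : g.Homotopic (ContinuousMap.id _)) (p : K.boundary) :
    (Path.Homotopic.Quotient.mk (K.meridian p)).map g = .mk (K.meridian (g p)) := by
  obtain ⟨H⟩ := h
  have h1 : ((Path.Homotopic.Quotient.mk (K.meridian p)).map g).trans (.mk (H.evalAt p)) =
      (Path.Homotopic.Quotient.mk (H.evalAt p)).trans ((Path.Homotopic.Quotient.mk (K.meridian p)).map (ContinuousMap.id _)) :=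
    Path.Homotopic.Quotient.eq.2 (Path.Homotopic.map_trans_evalAt H (K.meridian p))
  exact Path.Homotopic.Quotient.trans_right_cancel (h1.trans (meridian_trans_quotient (H.evalAt p)).symm)

lemma meridian_map_boundaryInv (p : K.boundary) :
    (K.meridian p).map K.boundaryInv.continuous = (K.meridian (K.boundaryInv p)).symm := by
  refine Path.ext (funext fun t => ?_)
  change K.boundaryInv (K.meridianCircle p (Circle.exp (2 * Real.pi * t))) =
    K.meridianCircle (K.boundaryInv p) (Circle.exp (2 * Real.pi * (σ t : I)))
  rw [boundaryInv_meridianCircle]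
  congr 1
  simp [mul_sub, Circle.exp_sub]

lemma map_meridian_of_homotopic_boundaryInv {g : C(K.boundary, K.boundary)}
    (h : g.Homotopic K.boundaryInv) (p : K.boundary) :
    (Path.Homotopic.Quotient.mk (K.meridian p)).map g = (Path.Homotopic.Quotient.mk (K.meridian (g p))).symm := by
  obtain ⟨H⟩ := h
  have h1 : ((Path.Homotopic.Quotient.mk (K.meridian p)).map g).trans (.mk (H.evalAt p)) =
      (Path.Homotopic.Quotient.mk (H.evalAt p)).trans (Path.Homotopic.Quotient.mk (K.meridian (K.boundaryInv p))).symm := by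
    rw [← Path.Homotopic.Quotient.mk_symm, ← meridian_map_boundaryInv]
    exact Path.Homotopic.Quotient.eq.2 (Path.Homotopic.map_trans_evalAt H (K.meridian p))
  have h2 := meridian_trans_quotient (H.evalAt p)
  refine Path.Homotopic.Quotient.trans_right_cancel (r := .mk (H.evalAt p)) (h1.trans ?_)
  -- Multiplying by the meridian at `g p` lets it slide along the track and cancel the inverse
  -- meridian at the other end.
  refine Path.Homotopic.Quotient.trans_left_cancel (p := .mk (K.meridian (g p))) ?_
  rw [← Path.Homotopic.Quotient.trans_assoc, h2, Path.Homotopic.Quotient.trans_assoc, Path.Homotopic.Quotient.trans_symm, Path.Homotopic.Quotient.trans_refl,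
    ← Path.Homotopic.Quotient.trans_assoc, Path.Homotopic.Quotient.trans_symm, Path.Homotopic.Quotient.refl_trans]

/-! ### The induced map on the fundamental quandle -/

namespace FundQuandle

variable (f : S3 ≃ₜ S3) (hN : f '' K.nbhd = K.nbhd) (γ : Path (K.exteriorHomeo f hN z) z)

/-- One direction makes `f_*` well defined, the other makes it injective. -/
lemma image_homotopic_iff (a b : K.Arc z) :
    (a.image f hN γ).Homotopic (b.image f hN γ) ↔ a.Homotopic b := by
  rw [Arc.homotopic_iff', Arc.homotopic_iff']
  constructor
  · rintro ⟨n, hn⟩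
    obtain ⟨m, rfl⟩ := (K.boundaryHomeo f hN).exists_path_map_eq n
    refine ⟨m, Path.Homotopic.Quotient.map_injective (K.exteriorHomeo f hN) ?_⟩
    exact Path.Homotopic.Quotient.map_eq_of_trans_eq
      (f := (K.exteriorHomeo f hN : C(K.exterior, K.exterior))) (r := .mk γ) hn
  · rintro ⟨n, hn⟩
    refine ⟨n.map (K.boundaryHomeo f hN).continuous, ?_⟩
    exact Path.Homotopic.Quotient.map_trans_eq_of_eq
      (K.exteriorHomeo f hN : C(K.exterior, K.exterior)) (.mk γ) hn

/-- The map `f_*[a] = [(f ∘ a) · γ]` of the fundamental quandle. -/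
noncomputable def map : FundQuandle K z → FundQuandle K z :=
  _root_.Quotient.map (Arc.image f hN γ) fun a b h => (image_homotopic_iff f hN γ a b).2 h

lemma map_mk (a : K.Arc z) : map f hN γ (mk a) = mk (a.image f hN γ) := rfl

lemma map_bijective : Function.Bijective (map f hN γ) := by
  constructor
  · intro x y h
    induction x using ind with | h a =>
    induction y using ind with | h b =>
    rw [map_mk, map_mk, mk_eq_iff, image_homotopic_iff] at h
    exact (mk_eq_iff a b).2 h
  · intro y
    induction y using ind with | h b =>
    obtain ⟨q, b⟩ := b
    obtain ⟨p, rfl⟩ := (K.boundaryHomeo f hN).surjective q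
    -- The preimage of `b` is `f⁻¹ ∘ (b · γ̄)`.
    obtain ⟨c, hc⟩ := (K.exteriorHomeo f hN).exists_path_map_eq (x := K.incl p) (y := z)
      (b.trans γ.symm)
    refine ⟨mk ⟨p, c⟩, ?_⟩
    rw [map_mk]
    refine mk_eq_of_path (p := K.boundaryHomeo f hN p) ?_
    rw [hc]
    change Path.Homotopic.Quotient.mk ((b.trans γ.symm).trans γ) = Path.Homotopic.Quotient.mk b
    rw [Path.Homotopic.Quotient.mk_trans, Path.Homotopic.Quotient.mk_trans, Path.Homotopic.Quotient.mk_symm, Path.Homotopic.Quotient.trans_assoc,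
      Path.Homotopic.Quotient.symm_trans, Path.Homotopic.Quotient.trans_refl]

/-- The homomorphism `[g] ↦ [γ̄ · (f ∘ g) · γ]` of the knot group. -/
noncomputable def loopMap (g : Path.Homotopic.Quotient z z) : Path.Homotopic.Quotient z z :=
  (Path.Homotopic.Quotient.mk γ).symm.trans
    ((g.map (K.exteriorHomeo f hN : C(K.exterior, K.exterior))).trans (.mk γ))

lemma map_act (x : FundQuandle K z) (g : Path.Homotopic.Quotient z z) :
    map f hN γ (act x g) = act (map f hN γ x) (loopMap f hN γ g) := by
  induction x using ind with | h a =>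
  induction g with | mk g =>
  change mk _ = mk ⟨_, (a.image f hN γ).path.trans
    (γ.symm.trans ((g.map (K.exteriorHomeo f hN).continuous).trans γ))⟩
  refine mk_eq_of_path (p := K.boundaryHomeo f hN a.start) ?_
  exact Path.Homotopic.Quotient.map_trans_trans
    (K.exteriorHomeo f hN : C(K.exterior, K.exterior)) (.mk a.path) (.mk g) (.mk γ)

/-- Written so as to differ from `bd_map_mk` only in the meridian: its image under `f` here, the
meridian at the image point there. -/
lemma loopMap_bd_mk (b : K.Arc z) : loopMap f hN γ (bd (mk b)) =
    (Path.Homotopic.Quotient.mk (b.image f hN γ).path).symm.trans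
      ((((Path.Homotopic.Quotient.mk (K.meridian b.start)).map
        (K.boundaryHomeo f hN : C(K.boundary, K.boundary))).map K.incl).trans
          (.mk (b.image f hN γ).path)) := by
  exact Path.Homotopic.Quotient.map_conj
    (K.exteriorHomeo f hN : C(K.exterior, K.exterior)) (.mk b.path)
    ((Path.Homotopic.Quotient.mk (K.meridian b.start)).map K.incl) (.mk γ)

lemma bd_map_mk (b : K.Arc z) : bd (map f hN γ (mk b)) =
    (Path.Homotopic.Quotient.mk (b.image f hN γ).path).symm.trans
      (((Path.Homotopic.Quotient.mk (K.meridian (K.boundaryHomeo f hN b.start))).map K.incl).trans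
        (.mk (b.image f hN γ).path)) := rfl

lemma isAut_map
    (h : (K.boundaryHomeo f hN : C(K.boundary, K.boundary)).Homotopic (ContinuousMap.id _)) :
    IsAut (map f hN γ) := by
  refine ⟨map_bijective f hN γ, fun x y => ?_⟩
  change map f hN γ (act x (bd y)) = act (map f hN γ x) (bd (map f hN γ y))
  rw [map_act]
  congr 1
  induction y using ind with | h b =>
  rw [loopMap_bd_mk, bd_map_mk, map_meridian_of_homotopic_id h]
  rfl

lemma isAntiAut_map
    (h : (K.boundaryHomeo f hN : C(K.boundary, K.boundary)).Homotopic K.boundaryInv) :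
    IsAntiAut (map f hN γ) := by
  refine ⟨map_bijective f hN γ, fun x y => ?_⟩
  change map f hN γ (act x (bd y)) = act (map f hN γ x) (bd (map f hN γ y)).symm
  rw [map_act]
  congr 1
  induction y using ind with | h b =>
  rw [loopMap_bd_mk, bd_map_mk, map_meridian_of_homotopic_boundaryInv h]
  exact Path.Homotopic.Quotient.conj_map_symm _ _ _

/-- The fixed basepoint case is the general one with `γ` constant; the cast is needed because `f(z)
= z` is only a propositional equality. -/
lemma mk_image₀ (hz : K.exteriorHomeo f hN z = z) (a : K.Arc z) :
    mk (a.image f hN ((Path.refl z).cast hz rfl)) = mk (a.image₀ f hN hz) := by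
  refine mk_eq_of_path (p := K.boundaryHomeo f hN a.start) ?_
  have : (a.path.map (K.exteriorHomeo f hN).continuous).trans ((Path.refl z).cast hz rfl) =
      ((a.path.map (K.exteriorHomeo f hN).continuous).cast rfl hz.symm).trans (Path.refl z) := by
    ext t
    simp [Path.trans_apply]
  rw [this]
  exact Path.Homotopic.Quotient.trans_refl (.mk _)

end FundQuandle

end Knot

theorem proposition1 (K : Knot) (z : K.exterior) (f : S3 ≃ₜ S3)
    (hK : f '' K.carrier = K.carrier) (hN : f '' K.nbhd = K.nbhd)
    (hf : K.boundaryClass f hN = 1 ∨ K.boundaryClass f hN = MCG.negOne) :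
    (K.PreservesNormalOrientation f ∨ K.ReversesNormalOrientation f) ∧
    (∀ hz : K.exteriorHomeo f hN z = z,
      ∃ F : K.FundQuandle z → K.FundQuandle z,
        (∀ a : K.Arc z, F (.mk a) = .mk (a.image₀ f hN hz)) ∧
        (K.PreservesNormalOrientation f → Knot.FundQuandle.IsAut F) ∧
        (K.ReversesNormalOrientation f → Knot.FundQuandle.IsAntiAut F)) ∧
    Nonempty (Path (K.exteriorHomeo f hN z) z) ∧
    (∀ γ : Path (K.exteriorHomeo f hN z) z,
      ∃ F : K.FundQuandle z → K.FundQuandle z,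
        (∀ a : K.Arc z, F (.mk a) = .mk (a.image f hN γ)) ∧
        (K.PreservesNormalOrientation f → Knot.FundQuandle.IsAut F) ∧
        (K.ReversesNormalOrientation f → Knot.FundQuandle.IsAntiAut F)) := by
  have hmap : ∀ γ : Path (K.exteriorHomeo f hN z) z,
      (K.PreservesNormalOrientation f → Knot.FundQuandle.IsAut (.map f hN γ)) ∧
      (K.ReversesNormalOrientation f → Knot.FundQuandle.IsAntiAut (.map f hN γ)) := by
    intro γ
    -- The mapping class already decides the orientation behaviour, so in each case the opposite
    -- orientation hypothesis is contradictory.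
    rcases hf with hf | hf
    · have h := Knot.boundaryHomeo_homotopic_id hf
      exact ⟨fun _ => Knot.FundQuandle.isAut_map f hN γ h, fun hr =>
        (Knot.not_preserves_and_reverses
          (Knot.preservesNormalOrientation_of_homotopic h) hr).elim⟩
    · have h := Knot.boundaryHomeo_homotopic_boundaryInv hf
      exact ⟨fun hp => (Knot.not_preserves_and_reverses hp
          (Knot.reversesNormalOrientation_of_homotopic h)).elim,
        fun _ => Knot.FundQuandle.isAntiAut_map f hN γ h⟩
  refine ⟨?_, fun hz => ?_, Knot.exterior_joined _ _, fun γ => ?_⟩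
  · exact hf.imp
      (fun h => Knot.preservesNormalOrientation_of_homotopic (Knot.boundaryHomeo_homotopic_id h))
      (fun h => Knot.reversesNormalOrientation_of_homotopic
        (Knot.boundaryHomeo_homotopic_boundaryInv h))
  · exact ⟨.map f hN ((Path.refl z).cast hz rfl), Knot.FundQuandle.mk_image₀ f hN hz, hmap _⟩
  · exact ⟨.map f hN γ, fun _ => rfl, hmap γ⟩
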